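/- Let $(\Omega_i,\mathcal M_i,\mu_i)$, $i=1,2$, be $\sigma$-finite measure spaces, let $K\in L^2(\mu_2\otimes\mu_1)$ (complex valued), and let $T:L^2(\mu_1)\to L^2(\mu_2)$ be the bounded operator $$(Tf)(x)=\int_{\Omega_1}K(x,y)f(y)\,d\mu_1(y).$$ Say that an operator $E$ on $L^2(\mu)$ is *admissible with exponent $p>0$* if $E$ is essentially self-adjoint; the spectrum of its closure consists of a (finite or infinite) sequence of strictly positive eigenvalues $\lambda_j$, repeated according to multiplicity and with only finitely many in each bounded set, with a corresponding orthonormal basis of $L^2(\mu)$ of eigenvectors; and, for some $C>0$, the eigenvalue counting function satisfies $$N(\lambda):=\#\{j:\lambda_j\le\lambda\}\le C(1+\lambda)^{p}\qquad\text{for all }\lambda>0 .$$ For $E$ on $L^2(\mu_1)$ and functions $F,G$ on $\Omega_2\times\Omega_1$ with $G$ measurable, $E_yF=G$ means that for $\mu_2$-almost every $x$ the function $F(x,\cdot)$ lies in the domain of the closure $\overline{E}$ and $\overline{E}\,(F(x,\cdot))=G(x,\cdot)$; $E_xF=G$ is defined in the same way, for $E$ on $L^2(\mu_2)$, in the first variable.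 Let $s_1(T)\ge s_2(T)\ge\dots\ge 0$ be the singular values of a compact operator $T$, that is, the eigenvalues of $|T|=(T^*T)^{1/2}$ counted with multiplicity in decreasing order (followed by zeros if there are only finitely many positive ones); for $0<r<\infty$, $T\in S_r$ means that $T$ is compact and $\sum_k s_k(T)^r<\infty$. (i) Let $E_i$ be an operator on $L^2(\mu_i)$ that is admissible with exponent $p_i>0$, $i=1,2$. If $(E_2)_x(E_1)_yK\in L^2(\mu_2\otimes\mu_1)$, then $T\in S_r(L^2(\mu_1),L^2(\mu_2))$ for all $0<r<\infty$ with $$\frac1r<\frac12+\frac1{p_1}+\frac1{p_2},$$ and moreover $$s_k(T)=o\Bigl(k^{-\left(\frac12+\frac1{p_1}+\frac1{p_2}\right)}\Bigr)\qquad(k\to\infty).$$ (ii) Let $E$ be admissible with exponent $p>0$. If either $E$ acts on $L^2(\mu_1)$ and $E_yK\in L^2(\mu_2\otimes\mu_1)$, or $E$ acts on $L^2(\mu_2)$ and $E_xK\in L^2(\mu_2\otimes\mu_1)$, then $T\in S_r(L^2(\mu_1),L^2(\mu_2))$ for all $0<r<\infty$ with $$\frac1r<\frac12+\frac1p,$$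 and moreover $$s_k(T)=o\Bigl(k^{-\left(\frac12+\frac1p\right)}\Bigr)\qquad(k\to\infty).$$ -/

import Mathlib

open MeasureTheory Filter Asymptotics
open scoped ENNReal

noncomputable section

section UnboundedOperators

variable {H : Type*} [NormedAddCommGroup H] [InnerProductSpace ℂ H] [CompleteSpace H]

/-- A (partially defined) operator is essentially self-adjoint if it is closable and its closure is
self-adjoint. (Density of the domain is then automatic.) -/
def IsEssentiallySelfAdjoint (E : H →ₗ.[ℂ] H) : Prop :=
  E.IsClosable ∧ IsSelfAdjoint E.closure

/-- The spectrum of an unbounded operator `A`: the complement of the set of `z` for which `A - z`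
has an everywhere defined bounded two-sided inverse `R`. -/
def unboundedSpectrum (A : H →ₗ.[ℂ] H) : Set ℂ :=
  {z | ¬ ∃ R : H →L[ℂ] H,
    (∀ f : H, ∃ h : R f ∈ A.domain, A ⟨R f, h⟩ - z • R f = f) ∧
    (∀ u : A.domain, R (A u - z • (u : H)) = u)}

/-- The spectrum of `A` is discrete and strictly positive, and consists of the family of eigenvalues
`lam` (repeated according to multiplicity), with a corresponding orthonormal basis of eigenvectors.
The index set is `ℕ` for an infinite sequence of eigenvalues, and is finite if `H` is
finite dimensional. -/
structure HasDiscretePositiveSpectrum (A : H →ₗ.[ℂ] H) {ι : Type*} (lam : ι → ℝ) : Prop where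
  pos : ∀ j, 0 < lam j
  discrete : ∀ L : ℝ, {j | lam j ≤ L}.Finite
  spectrum_eq : unboundedSpectrum A = Set.range (fun j => (lam j : ℂ))
  eigenbasis : ∃ b : HilbertBasis ι ℂ H,
    ∀ j, ∃ h : b j ∈ A.domain, A ⟨b j, h⟩ = (lam j : ℂ) • b j

/-- The eigenvalue counting function `N(L) = #{j : lam j ≤ L}`. -/
def eigenvalueCount {ι : Type*} (lam : ι → ℝ) (L : ℝ) : ℕ := {j | lam j ≤ L}.ncard

end UnboundedOperators

section Schatten

variable {H₁ H₂ : Type*} [NormedAddCommGroup H₁] [InnerProductSpace ℂ H₁] [CompleteSpace H₁]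
  [NormedAddCommGroup H₂] [InnerProductSpace ℂ H₂] [CompleteSpace H₂]

/-- The absolute value `|T| = (T* T)^(1/2)`. -/
def operatorAbs (T : H₁ →L[ℂ] H₂) : H₁ →L[ℂ] H₁ :=
  CFC.sqrt ((ContinuousLinearMap.adjoint T).comp T)

/-- The singular values of a compact operator `T`, indexed from `0`: `singularValue T k` is the
`(k+1)`-st largest eigenvalue of `|T|` (with multiplicity), i.e. the largest `σ > 0` such that there
are `k + 1` orthonormal eigenvectors of `|T|` with eigenvalues at least `σ`, and `0` if there is no
such `σ`. -/
def singularValue (T : H₁ →L[ℂ] H₂) (k : ℕ) : ℝ :=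
  sSup {σ : ℝ | 0 < σ ∧ ∃ v : Fin (k + 1) → H₁, Orthonormal ℂ v ∧
    ∀ i, ∃ τ : ℝ, σ ≤ τ ∧ operatorAbs T (v i) = (τ : ℂ) • v i}

/-- The Schatten-von Neumann class `S_r`, `0 < r < ∞`: compact operators with `ℓ^r` singular
values. -/
def MemSchatten (r : ℝ) (T : H₁ →L[ℂ] H₂) : Prop :=
  IsCompactOperator T ∧ Summable (fun k => singularValue T k ^ r)

end Schatten

section Kernels

variable {Ω₁ Ω₂ : Type*} [MeasurableSpace Ω₁] [MeasurableSpace Ω₂]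
  {μ₁ : Measure Ω₁} {μ₂ : Measure Ω₂}

/-- `A_y F = G`: for almost every `x` the function `F (x, ·)` is in the domain of `A`, and
`A (F (x, ·)) = G (x, ·)`, where `G` is a (jointly) measurable function. -/
def ActsOnY (μ₂ : Measure Ω₂) (A : Lp ℂ 2 μ₁ →ₗ.[ℂ] Lp ℂ 2 μ₁) (F G : Ω₂ × Ω₁ → ℂ) : Prop :=
  AEStronglyMeasurable G (μ₂.prod μ₁) ∧
  ∀ᵐ x ∂μ₂, ∃ (hF : MemLp (fun y => F (x, y)) 2 μ₁) (hdom : hF.toLp ∈ A.domain),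
    A ⟨hF.toLp, hdom⟩ =ᵐ[μ₁] fun y => G (x, y)

/-- `A_x F = G`: for almost every `y` the function `F (·, y)` is in the domain of `A`, and
`A (F (·, y)) = G (·, y)`, where `G` is a (jointly) measurable function. -/
def ActsOnX (μ₁ : Measure Ω₁) (A : Lp ℂ 2 μ₂ →ₗ.[ℂ] Lp ℂ 2 μ₂) (F G : Ω₂ × Ω₁ → ℂ) : Prop :=
  AEStronglyMeasurable G (μ₂.prod μ₁) ∧
  ∀ᵐ y ∂μ₁, ∃ (hF : MemLp (fun x => F (x, y)) 2 μ₂) (hdom : hF.toLp ∈ A.domain),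
    A ⟨hF.toLp, hdom⟩ =ᵐ[μ₂] fun x => G (x, y)

variable [SigmaFinite μ₁] {K : Ω₂ × Ω₁ → ℂ}

theorem sq_eLpNorm_two {α : Type*} [MeasurableSpace α] (μ : Measure α) (f : α → ℂ) :
    eLpNorm f 2 μ ^ 2 = ∫⁻ a, ‖f a‖ₑ ^ 2 ∂μ := by
  have h := eLpNorm_nnreal_pow_eq_lintegral (μ := μ) (f := f) (p := 2) (by norm_num)
  simpa using h

theorem kernel_slice_memLp (hK : MemLp K 2 (μ₂.prod μ₁)) :
    ∀ᵐ x ∂μ₂, MemLp (fun y => K (x, y)) 2 μ₁ := by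
  have hm : AEMeasurable (fun z => ‖K z‖ₑ ^ 2) (μ₂.prod μ₁) := hK.1.enorm.pow_const 2
  have h2 : ∫⁻ z, ‖K z‖ₑ ^ 2 ∂(μ₂.prod μ₁) ≠ ∞ := by
    rw [← sq_eLpNorm_two]; exact (ENNReal.pow_lt_top hK.2).ne
  rw [lintegral_prod _ hm] at h2
  have h3 := ae_lt_top' hm.lintegral_prod_right' h2
  filter_upwards [h3, hK.1.prodMk_left] with x hx hx'
  refine ⟨hx', ?_⟩
  rw [← sq_eLpNorm_two] at hx
  by_contra hne
  rw [not_lt, top_le_iff] at hne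
  simp [hne] at hx

theorem kernel_integral_bound (hK : MemLp K 2 (μ₂.prod μ₁)) {f : Ω₁ → ℂ} (hf : MemLp f 2 μ₁) :
    eLpNorm (fun x => ∫ y, K (x, y) * f y ∂μ₁) 2 μ₂
      ≤ eLpNorm K 2 (μ₂.prod μ₁) * eLpNorm f 2 μ₁ := by
  have hm : AEMeasurable (fun z => ‖K z‖ₑ ^ 2) (μ₂.prod μ₁) := hK.1.enorm.pow_const 2
  rw [← ENNReal.pow_le_pow_left_iff (n := 2) (by norm_num), mul_pow, sq_eLpNorm_two,
    sq_eLpNorm_two _ K, lintegral_prod _ hm, ← lintegral_mul_const'' _ hm.lintegral_prod_right']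
  refine lintegral_mono_ae ?_
  filter_upwards [kernel_slice_memLp hK] with x hx
  rw [← sq_eLpNorm_two μ₁ (fun y => K (x, y)), ← mul_pow]
  refine pow_le_pow_left' ((enorm_integral_le_lintegral_enorm _).trans ?_) 2
  rw [← eLpNorm_one_eq_lintegral_enorm]
  have h := eLpNorm_smul_le_mul_eLpNorm (p := 2) (q := 2) (r := 1) hf.1 hx.1
  exact h

theorem kernel_integral_memLp (hK : MemLp K 2 (μ₂.prod μ₁)) {f : Ω₁ → ℂ} (hf : MemLp f 2 μ₁) :
    MemLp (fun x => ∫ y, K (x, y) * f y ∂μ₁) 2 μ₂ :=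
  ⟨AEStronglyMeasurable.integral_prod_right' (f := fun z : Ω₂ × Ω₁ => K z * f z.2)
      (hK.1.mul hf.1.comp_snd),
    (kernel_integral_bound hK hf).trans_lt (ENNReal.mul_lt_top hK.2 hf.2)⟩

/-- The integral operator `T : L²(μ₁) → L²(μ₂)`, `(T f)(x) = ∫ K(x,y) f(y) dμ₁(y)`, with kernel
`K ∈ L²(μ₂ ⊗ μ₁)`. -/
def integralOperator (hK : MemLp K 2 (μ₂.prod μ₁)) : Lp ℂ 2 μ₁ →L[ℂ] Lp ℂ 2 μ₂ :=
  LinearMap.mkContinuous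
    { toFun := fun f => (kernel_integral_memLp hK (Lp.memLp f)).toLp
      map_add' := by
        intro f g
        rw [← MemLp.toLp_add]
        refine MemLp.toLp_congr _ _ ?_
        filter_upwards [kernel_slice_memLp hK] with x hx
        have h1 : Integrable (fun y => K (x, y) * f y) μ₁ := hx.integrable_mul (Lp.memLp f)
        have h2 : Integrable (fun y => K (x, y) * g y) μ₁ := hx.integrable_mul (Lp.memLp g)
        simp only [Pi.add_apply]
        rw [← integral_add h1 h2]
        refine integral_congr_ae ?_
        filter_upwards [Lp.coeFn_add f g] with y hy
        rw [hy, Pi.add_apply, mul_add]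
      map_smul' := by
        intro c f
        rw [RingHom.id_apply, ← MemLp.toLp_const_smul]
        refine MemLp.toLp_congr _ _ (Eventually.of_forall fun x => ?_)
        simp only [Pi.smul_apply, smul_eq_mul]
        rw [← integral_const_mul]
        refine integral_congr_ae ?_
        filter_upwards [Lp.coeFn_smul c f] with y hy
        simp only [hy, Pi.smul_apply, smul_eq_mul]
        ring }
    (eLpNorm K 2 (μ₂.prod μ₁)).toReal
    (by
      intro f
      change ‖(kernel_integral_memLp hK (Lp.memLp f)).toLp‖ ≤ _
      rw [Lp.norm_toLp, Lp.norm_def, ← ENNReal.toReal_mul]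
      exact ENNReal.toReal_mono (ENNReal.mul_lt_top hK.2 (Lp.memLp f).2).ne
        (kernel_integral_bound hK (Lp.memLp f)))

theorem integralOperator_apply (hK : MemLp K 2 (μ₂.prod μ₁)) (f : Lp ℂ 2 μ₁) :
    integralOperator hK f =ᵐ[μ₂] fun x => ∫ y, K (x, y) * f y ∂μ₁ :=
  MemLp.coeFn_toLp (kernel_integral_memLp hK (Lp.memLp f))

end Kernels

end

set_option linter.unusedSectionVars false

/-! ### Matrix entries, compactness and singular values in abstract Hilbert spaces. -/

section HilbertSpace

open scoped InnerProductSpace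

variable {H₁ H₂ : Type*} [NormedAddCommGroup H₁] [InnerProductSpace ℂ H₁] [CompleteSpace H₁]
  [NormedAddCommGroup H₂] [InnerProductSpace ℂ H₂] [CompleteSpace H₂] {ι₁ ι₂ : Type*}

/-! Applying an operator with eigenbasis `b` and eigenvalues `lam` to the kernel multiplies the
matrix entries of the integral operator by `lam`: entries are taken against eigenvectors in the
first variable, and against conjugated eigenvectors in the second (`ActsOnX.inner_integralOperator`,
`ActsOnY.integralOperator_star`). So the matrix of `T` is a square summable matrix, that of the
transformed kernel, divided by eigenvalues. The counting bound makes these at least a constant times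
`(n + 1) ^ (1 / p)` once `n` indices are removed (`exists_finset`).

Decay then follows by a dimension count (`nat_mul_sq_le_tsum_indicator`). If `|T|` has `3n + 1`
orthonormal eigenvectors with eigenvalues at least `σ`, prescribing zero components on `n` rows and
`n` columns leaves a subspace of dimension at least `n + 1` on which `T` is bounded below by `σ`.
Hence `(n + 1) * σ ^ 2` is at most the squared Hilbert-Schmidt norm of the remaining matrix. That
norm gains both eigenvalue factors at once, so the rates `1 / p₁` and `1 / p₂` add up; the `1 / 2`
comes from the factor `n + 1`, and the little-o from the vanishing tail of the square summable
matrix (`singularValue_isLittleO`). -/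

theorem HilbertBasis.hasSum_sq_norm_inner (b : HilbertBasis ι₁ ℂ H₁) (x : H₁) :
    HasSum (fun i => ‖⟪b i, x⟫_ℂ‖ ^ 2) (‖x‖ ^ 2) := by
  have h := Complex.hasSum_re (b.hasSum_inner_mul_inner x x)
  convert h using 1
  · funext i
    rw [← inner_conj_symm x (b i), RCLike.conj_mul]
    norm_cast
  · rw [inner_self_eq_norm_sq_to_K]
    norm_cast

theorem HilbertBasis.summable_matrix_of_summable_columns (d : HilbertBasis ι₂ ℂ H₂)
    {u : ι₁ → H₂} (hu : Summable fun j => ‖u j‖ ^ 2) :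
    Summable fun q : ι₂ × ι₁ => ‖⟪d q.1, u q.2⟫_ℂ‖ ^ 2 := by
  have hswap : Summable fun q : ι₁ × ι₂ => ‖⟪d q.2, u q.1⟫_ℂ‖ ^ 2 := by
    rw [summable_prod_of_nonneg fun _ => by positivity]
    refine ⟨fun j => (d.hasSum_sq_norm_inner (u j)).summable, hu.congr fun j => ?_⟩
    exact (d.hasSum_sq_norm_inner (u j)).tsum_eq.symm
  exact hswap.prod_symm

theorem isCompactOperator_smulRight (φ : H₁ →L[ℂ] ℂ) (y : H₂) :
    IsCompactOperator (φ.smulRight y) := by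
  have hφ : IsCompactOperator φ :=
    ⟨Metric.closedBall 0 1, isCompact_closedBall 0 1,
      φ.continuous.continuousAt (by
        rw [map_zero]; exact Metric.closedBall_mem_nhds _ one_pos)⟩
  have h := hφ.clm_comp (ContinuousLinearMap.toSpanSingleton ℂ y)
  exact h

/-- An operator with square summable matrix columns is compact. -/
theorem isCompactOperator_of_summable (T : H₁ →L[ℂ] H₂) (d : HilbertBasis ι₂ ℂ H₂)
    (hT : Summable fun i => ‖ContinuousLinearMap.adjoint T (d i)‖ ^ 2) :
    IsCompactOperator T := by
  classical
  set a : ι₂ → ℝ := fun i => ‖ContinuousLinearMap.adjoint T (d i)‖ ^ 2 with ha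
  -- The truncation `F J` is `P_J T`, with `P_J` the projection onto the span of `d i`, `i ∈ J`; it
  -- has finite rank.
  set F : Finset ι₂ → H₁ →L[ℂ] H₂ := fun J =>
    ∑ i ∈ J, (innerSL ℂ (ContinuousLinearMap.adjoint T (d i))).smulRight (d i) with hF
  have hcomp : ∀ J, IsCompactOperator (F J) := by
    intro J
    induction J using Finset.induction_on with
    | empty => simpa [hF] using (isCompactOperator_zero (M₁ := H₁) (M₂ := H₂))
    | insert i J hi ih =>
      simp only [hF, Finset.sum_insert hi]
      exact (isCompactOperator_smulRight _ _).add ih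
  refine isCompactOperator_of_tendsto (l := atTop) (F := F) ?_ (Eventually.of_forall hcomp)
  rw [tendsto_iff_norm_sub_tendsto_zero]
  have htail : Tendsto (fun J : Finset ι₂ => √(∑' i : {i // i ∉ J}, a i)) atTop (nhds 0) := by
    have := (tendsto_tsum_compl_atTop_zero a).sqrt
    simpa using this
  refine squeeze_zero (fun _ => norm_nonneg _) (fun J => ?_) htail
  refine ContinuousLinearMap.opNorm_le_bound _ (Real.sqrt_nonneg _) fun x => ?_
  refine le_of_sq_le_sq ?_ (by positivity)
  have hnn : 0 ≤ ∑' i : {i // i ∉ J}, a i := tsum_nonneg fun i => by positivity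
  rw [mul_pow, Real.sq_sqrt hnn]
  have hS : HasSum (fun i => Set.indicator {i | i ∉ J} a i * ‖x‖ ^ 2)
      ((∑' i : {i // i ∉ J}, a i) * ‖x‖ ^ 2) := by
    refine HasSum.mul_right _ ?_
    have h1 := (hT.indicator {i | i ∉ J}).hasSum
    rwa [← tsum_subtype] at h1
  refine hasSum_le (fun i => ?_) (d.hasSum_sq_norm_inner _) hS
  have hin : ⟪d i, (F J - T) x⟫_ℂ =
      (if i ∈ J then ⟪d i, T x⟫_ℂ else 0) - ⟪d i, T x⟫_ℂ := by
    have horth := orthonormal_iff_ite.mp d.orthonormal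
    simp [hF, horth, ContinuousLinearMap.adjoint_inner_left]
  rw [hin]
  by_cases hi : i ∈ J
  · simp [hi]
  · rw [Set.indicator_of_mem (by exact hi)]
    simp only [hi, if_false, zero_sub, norm_neg, ha]
    rw [← mul_pow, ← ContinuousLinearMap.adjoint_inner_left]
    gcongr
    exact norm_inner_le_norm _ _

/-- Follows from `|T|² = T*T`. It turns eigenvalue bounds for `|T|` into lower bounds for `T`
without a polar decomposition. -/
theorem norm_operatorAbs_apply (T : H₁ →L[ℂ] H₂) (x : H₁) : ‖operatorAbs T x‖ = ‖T x‖ := by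
  have hpos : 0 ≤ (ContinuousLinearMap.adjoint T).comp T :=
    (ContinuousLinearMap.nonneg_iff_isPositive _).2 T.isPositive_adjoint_comp_self
  have hmul : operatorAbs T * operatorAbs T = (ContinuousLinearMap.adjoint T).comp T :=
    CFC.sqrt_mul_sqrt_self _ hpos
  have hsa : IsSelfAdjoint (operatorAbs T) := (CFC.sqrt_nonneg _).isSelfAdjoint
  have h : ⟪operatorAbs T x, operatorAbs T x⟫_ℂ = ⟪T x, T x⟫_ℂ := by
    calc ⟪operatorAbs T x, operatorAbs T x⟫_ℂ
        = ⟪ContinuousLinearMap.adjoint (operatorAbs T) x, operatorAbs T x⟫_ℂ := by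
          rw [ContinuousLinearMap.isSelfAdjoint_iff'.mp hsa]
      _ = ⟪x, (operatorAbs T * operatorAbs T) x⟫_ℂ := by
          rw [ContinuousLinearMap.adjoint_inner_left]; rfl
      _ = ⟪T x, T x⟫_ℂ := by
          rw [hmul, ContinuousLinearMap.comp_apply, ContinuousLinearMap.adjoint_inner_right]
  rw [inner_self_eq_norm_sq_to_K, inner_self_eq_norm_sq_to_K] at h
  exact (sq_eq_sq₀ (norm_nonneg _) (norm_nonneg _)).mp (by exact_mod_cast h)

/-- An operator is bounded below on the span of orthonormal eigenvectors of `|T|`. -/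
theorem mul_norm_le_of_mem_span {ι : Type*} [Fintype ι] (T : H₁ →L[ℂ] H₂) {v : ι → H₁}
    (hv : Orthonormal ℂ v) {σ : ℝ} (hσ : 0 < σ)
    (hvT : ∀ i, ∃ τ : ℝ, σ ≤ τ ∧ operatorAbs T (v i) = (τ : ℂ) • v i) {w : H₁}
    (hw : w ∈ Submodule.span ℂ (Set.range v)) : σ ^ 2 * ‖w‖ ^ 2 ≤ ‖T w‖ ^ 2 := by
  classical
  choose τ hτ hτv using hvT
  obtain ⟨c, rfl⟩ := (Submodule.mem_span_range_iff_exists_fun ℂ).1 hw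
  have key : ∀ c : ι → ℂ, ‖∑ i, c i • v i‖ ^ 2 = ∑ i, ‖c i‖ ^ 2 := by
    intro c
    have h := hv.inner_sum c c Finset.univ
    rw [inner_self_eq_norm_sq_to_K] at h
    simp_rw [RCLike.conj_mul] at h
    exact_mod_cast h
  rw [← norm_operatorAbs_apply, map_sum]
  simp_rw [map_smul, hτv, smul_smul]
  rw [key, key, Finset.mul_sum]
  refine Finset.sum_le_sum fun i _ => ?_
  rw [norm_mul, mul_pow, mul_comm]
  have : σ ≤ ‖(τ i : ℂ)‖ := by
    rw [Complex.norm_real]; exact (hτ i).trans (le_abs_self _)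
  gcongr

/-- Orthonormal vectors that are orthogonal to part of an orthonormal basis satisfy Bessel's
inequality with respect to the remaining coefficients. -/
theorem HilbertBasis.sum_sq_norm_inner_le {ι : Type*} [Fintype ι] (e : HilbertBasis ι₁ ℂ H₁)
    (J : Finset ι₁) {w : ι → H₁} (hw : Orthonormal ℂ w) (hJ : ∀ l, ∀ j ∈ J, ⟪e j, w l⟫_ℂ = 0)
    (u : H₁) :
    ∑ l, ‖⟪u, w l⟫_ℂ‖ ^ 2 ≤ ∑' j, Set.indicator {j | j ∉ J} (fun j => ‖⟪u, e j⟫_ℂ‖ ^ 2) j := by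
  classical
  -- Removing the components along `J` does not change the pairing with the vectors `w l`, so
  -- Bessel's inequality may be applied to `u'`.
  set u' : H₁ := u - ∑ j ∈ J, ⟪e j, u⟫_ℂ • e j with hu'
  have h1 : ∀ l, ⟪u, w l⟫_ℂ = ⟪u', w l⟫_ℂ := by
    intro l
    rw [hu', inner_sub_left, sum_inner, Finset.sum_eq_zero, sub_zero]
    intro j hj
    rw [inner_smul_left, hJ l j hj, mul_zero]
  have h2 : ∀ j, ⟪e j, u'⟫_ℂ = if j ∈ J then 0 else ⟪e j, u⟫_ℂ := by
    intro j
    have horth := orthonormal_iff_ite.mp e.orthonormal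
    by_cases hj : j ∈ J <;>
      simp [hu', horth, hj]
  calc ∑ l, ‖⟪u, w l⟫_ℂ‖ ^ 2 = ∑ l, ‖⟪w l, u'⟫_ℂ‖ ^ 2 :=
        Finset.sum_congr rfl fun l _ => by rw [h1, norm_inner_symm]
    _ ≤ ‖u'‖ ^ 2 := hw.sum_inner_products_le u'
    _ = ∑' j, ‖⟪e j, u'⟫_ℂ‖ ^ 2 := (e.hasSum_sq_norm_inner u').tsum_eq.symm
    _ = _ := tsum_congr fun j => by
        rw [h2, Set.indicator_apply]
        by_cases hj : j ∈ J <;> simp [hj, norm_inner_symm (e j) u]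

/-- If `|T|` has more than `|J₁| + |J₂|` orthonormal eigenvectors with eigenvalues at least `σ`,
then `σ` is controlled by the matrix entries of `T` outside the rows `J₂` and the columns `J₁`. -/
theorem nat_mul_sq_le_tsum_indicator {k m : ℕ} (T : H₁ →L[ℂ] H₂) (e : HilbertBasis ι₁ ℂ H₁)
    (d : HilbertBasis ι₂ ℂ H₂)
    (hT : Summable fun q : ι₂ × ι₁ => ‖⟪d q.1, T (e q.2)⟫_ℂ‖ ^ 2)
    (J₁ : Finset ι₁) (J₂ : Finset ι₂) (hcard : J₁.card + J₂.card + m ≤ k)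
    {v : Fin k → H₁} (hv : Orthonormal ℂ v) {σ : ℝ} (hσ : 0 < σ)
    (hvT : ∀ i, ∃ τ : ℝ, σ ≤ τ ∧ operatorAbs T (v i) = (τ : ℂ) • v i) :
    m * σ ^ 2 ≤ ∑' q, Set.indicator {q : ι₂ × ι₁ | q.1 ∉ J₂ ∧ q.2 ∉ J₁}
      (fun q => ‖⟪d q.1, T (e q.2)⟫_ℂ‖ ^ 2) q := by
  classical
  set V := Submodule.span ℂ (Set.range v) with hV
  have hVfin : Module.finrank ℂ V = k := by
    rw [hV, finrank_span_eq_card hv.linearIndependent, Fintype.card_fin]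
  have : FiniteDimensional ℂ V := FiniteDimensional.span_of_finite ℂ (Set.finite_range v)
  -- The kernel of `Φ` consists of the `w` in `V` with no component along `J₁` and with `T w` having
  -- none along `J₂`; by rank-nullity its dimension is at least `k - |J₁| - |J₂|`.
  let Φ : V →ₗ[ℂ] (J₁ → ℂ) × (J₂ → ℂ) :=
    (LinearMap.pi fun j : J₁ => (innerSL ℂ (e j)).toLinearMap.comp V.subtype).prod
      (LinearMap.pi fun i : J₂ => (innerSL ℂ (d i)).toLinearMap.comp
        (T.toLinearMap.comp V.subtype))
  have hker : m ≤ Module.finrank ℂ Φ.ker := by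
    have h1 := Φ.finrank_range_add_finrank_ker
    have h2 := Φ.range.finrank_le
    rw [hVfin] at h1
    simp only [Module.finrank_prod, Module.finrank_fintype_fun_eq_card, Fintype.card_coe] at h2
    omega
  set r := Module.finrank ℂ Φ.ker with hr
  let o := stdOrthonormalBasis ℂ Φ.ker
  set w : Fin r → H₁ := fun l => ((o l : V) : H₁) with hw
  have hwo : Orthonormal ℂ w :=
    (o.orthonormal.comp_linearIsometry Φ.ker.subtypeₗᵢ).comp_linearIsometry V.subtypeₗᵢ
  have hwker : ∀ l, Φ (o l : V) = 0 := fun l => LinearMap.mem_ker.1 (o l).2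
  have hw1 : ∀ l, ∀ j ∈ J₁, ⟪e j, w l⟫_ℂ = 0 := fun l j hj =>
    congrFun (congrArg Prod.fst (hwker l)) ⟨j, hj⟩
  have hw2 : ∀ l, ∀ i ∈ J₂, ⟪d i, T (w l)⟫_ℂ = 0 := fun l i hi =>
    congrFun (congrArg Prod.snd (hwker l)) ⟨i, hi⟩
  have hlow : (m : ℝ) * σ ^ 2 ≤ ∑ l, ‖T (w l)‖ ^ 2 := by
    calc (m : ℝ) * σ ^ 2 ≤ r * σ ^ 2 := by gcongr
      _ = ∑ _l : Fin r, σ ^ 2 := by simp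
      _ ≤ _ := Finset.sum_le_sum fun l _ => by
        have := mul_norm_le_of_mem_span T hv hσ hvT (w := w l) (o l : V).2
        simpa [hwo.1 l] using this
  refine hlow.trans ?_
  have hind := hT.indicator {q : ι₂ × ι₁ | q.1 ∉ J₂ ∧ q.2 ∉ J₁}
  rw [hind.tsum_prod]
  refine hasSum_le (fun i => ?_)
    (hasSum_sum fun l (_ : l ∈ Finset.univ) => d.hasSum_sq_norm_inner (T (w l))) hind.prod.hasSum
  by_cases hi : i ∈ J₂
  · rw [Finset.sum_eq_zero fun l _ => by rw [hw2 l i hi]; simp]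
    exact tsum_nonneg fun j => Set.indicator_nonneg (fun _ _ => by positivity) _
  -- Row by row: the `i`-th components of the vectors `T (w l)` are the pairings of `T* (d i)` with
  -- `w l`.
  · have h := e.sum_sq_norm_inner_le J₁ hwo hw1 (ContinuousLinearMap.adjoint T (d i))
    simp_rw [ContinuousLinearMap.adjoint_inner_left] at h
    refine h.trans_eq (tsum_congr fun j => ?_)
    by_cases hj : j ∈ J₁ <;> simp [hi, hj]

theorem singularValue_nonneg (T : H₁ →L[ℂ] H₂) (k : ℕ) : 0 ≤ singularValue T k :=
  Real.sSup_nonneg fun _ h => h.1.le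

theorem nat_mul_singularValue_sq_le_tsum_indicator {k m : ℕ} (T : H₁ →L[ℂ] H₂)
    (e : HilbertBasis ι₁ ℂ H₁) (d : HilbertBasis ι₂ ℂ H₂)
    (hT : Summable fun q : ι₂ × ι₁ => ‖⟪d q.1, T (e q.2)⟫_ℂ‖ ^ 2)
    (J₁ : Finset ι₁) (J₂ : Finset ι₂) (hcard : J₁.card + J₂.card + m ≤ k + 1) :
    m * singularValue T k ^ 2 ≤ ∑' q, Set.indicator {q : ι₂ × ι₁ | q.1 ∉ J₂ ∧ q.2 ∉ J₁}
      (fun q => ‖⟪d q.1, T (e q.2)⟫_ℂ‖ ^ 2) q := by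
  have hB : 0 ≤ ∑' q, Set.indicator {q : ι₂ × ι₁ | q.1 ∉ J₂ ∧ q.2 ∉ J₁}
      (fun q => ‖⟪d q.1, T (e q.2)⟫_ℂ‖ ^ 2) q :=
    tsum_nonneg fun q => Set.indicator_nonneg (fun _ _ => by positivity) _
  rcases Nat.eq_zero_or_pos m with rfl | hm
  · simpa using hB
  have hm' : (0 : ℝ) < m := by exact_mod_cast hm
  rw [mul_comm, ← le_div_iff₀ hm']
  refine (Real.le_sqrt (singularValue_nonneg T k) (by positivity)).1 ?_
  -- Nonnegativity of the bound covers the empty set, whose supremum is `0`.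
  refine Real.sSup_le (fun σ hσ => ?_) (Real.sqrt_nonneg _)
  obtain ⟨hσ0, v, hv, hvT⟩ := hσ
  refine Real.le_sqrt_of_sq_le ?_
  rw [le_div_iff₀ hm', mul_comm]
  exact nat_mul_sq_le_tsum_indicator T e d hT J₁ J₂ hcard hv hσ0 hvT

/-- Decay of the singular values from a weighted Hilbert-Schmidt bound. -/
theorem singularValue_isLittleO (T : H₁ →L[ℂ] H₂)
    (e : HilbertBasis ι₁ ℂ H₁) (d : HilbertBasis ι₂ ℂ H₂)
    (hT : Summable fun q : ι₂ × ι₁ => ‖⟪d q.1, T (e q.2)⟫_ℂ‖ ^ 2)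
    (a : ι₂ × ι₁ → ℝ) (ha : Summable fun q => a q ^ 2) (β : ℝ) (hβ : 0 ≤ β)
    (J₁ : ℕ → Finset ι₁) (J₂ : ℕ → Finset ι₂)
    (hJ₁ : ∀ n, (J₁ n).card ≤ n) (hJ₂ : ∀ n, (J₂ n).card ≤ n)
    (hJ : ∀ q : ι₂ × ι₁, ∀ᶠ n in atTop, q.1 ∈ J₂ n ∨ q.2 ∈ J₁ n)
    (hbound : ∀ n, ∀ q : ι₂ × ι₁, q.1 ∉ J₂ n → q.2 ∉ J₁ n →
      ((n : ℝ) + 1) ^ β * ‖⟪d q.1, T (e q.2)⟫_ℂ‖ ≤ a q) :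
    (fun k : ℕ => singularValue T k) =o[atTop] fun k : ℕ => ((k : ℝ) + 1) ^ (-(1 / 2 + β)) := by
  classical
  set S : ℕ → Set (ι₂ × ι₁) := fun n => {q | q.1 ∉ J₂ n ∧ q.2 ∉ J₁ n} with hS
  set ε : ℕ → ℝ := fun n => ∑' q, (S n).indicator (fun q => a q ^ 2) q with hε
  have hεtend : Tendsto ε atTop (nhds 0) := by
    have h0 : (∑' _ : ι₂ × ι₁, (0 : ℝ)) = 0 := tsum_zero
    rw [← h0]
    -- Each index pair eventually leaves `S n`, and `a ^ 2` dominates.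
    refine tendsto_tsum_of_dominated_convergence ha (fun q => ?_)
      (Eventually.of_forall fun n q => ?_)
    · refine tendsto_const_nhds.congr' ?_
      filter_upwards [hJ q] with n hn
      rw [Set.indicator_of_notMem]
      simp only [hS, Set.mem_ofPred_eq]
      tauto
    · rw [Real.norm_eq_abs, abs_of_nonneg (Set.indicator_nonneg (fun _ _ => by positivity) _)]
      exact Set.indicator_le_self' (fun _ _ => by positivity) _
  have hε0 : ∀ n, 0 ≤ ε n := fun n =>
    tsum_nonneg fun q => Set.indicator_nonneg (fun _ _ => by positivity) _
  have hmain : ∀ n k : ℕ, 3 * n + 1 ≤ k + 1 →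
      singularValue T k ≤ √(ε n) * ((n : ℝ) + 1) ^ (-(1 / 2 + β)) := by
    intro n k hnk
    have hn : (0 : ℝ) < (n : ℝ) + 1 := by positivity
    -- Of the `k + 1 ≥ 3 * n + 1` dimensions, at most `2 * n` are lost to the rows and columns.
    have h1 := nat_mul_singularValue_sq_le_tsum_indicator (k := k) (m := n + 1) T e d hT
      (J₁ n) (J₂ n) (by have := hJ₁ n; have := hJ₂ n; omega)
    have h2 : (((n : ℝ) + 1) ^ β) ^ 2 * ∑' q, (S n).indicator
        (fun q => ‖⟪d q.1, T (e q.2)⟫_ℂ‖ ^ 2) q ≤ ε n := by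
      rw [← tsum_mul_left]
      refine Summable.tsum_le_tsum (fun q => ?_) ((hT.indicator _).mul_left _) (ha.indicator _)
      by_cases hq : q ∈ S n
      · rw [Set.indicator_of_mem hq, Set.indicator_of_mem hq, ← mul_pow]
        have := hbound n q hq.1 hq.2
        gcongr
      · rw [Set.indicator_of_notMem hq, Set.indicator_of_notMem hq, mul_zero]
    have h3 : (((n : ℝ) + 1) ^ (1 / 2 + β) * singularValue T k) ^ 2 ≤ ε n := by
      refine le_trans ?_ h2
      rw [mul_pow, Real.rpow_add hn, mul_pow, ← Real.sqrt_eq_rpow, Real.sq_sqrt hn.le]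
      calc ((n : ℝ) + 1) * (((n : ℝ) + 1) ^ β) ^ 2 * singularValue T k ^ 2
          = (((n : ℝ) + 1) ^ β) ^ 2 * (((n + 1 : ℕ) : ℝ) * singularValue T k ^ 2) := by
            push_cast; ring
        _ ≤ _ := by gcongr
    have h4 := Real.le_sqrt_of_sq_le h3
    rw [Real.rpow_neg hn.le, ← div_eq_mul_inv, le_div_iff₀ (by positivity), mul_comm]
    exact h4
  have hdiv : Tendsto (fun k : ℕ => k / 3) atTop atTop :=
    Nat.tendsto_div_const_atTop (by norm_num)
  have hγ : 0 ≤ 1 / 2 + β := by positivity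
  have hεk : Tendsto (fun k : ℕ => √(ε (k / 3)) * 3 ^ (1 / 2 + β)) atTop (nhds 0) := by
    have := ((hεtend.comp hdiv).sqrt).mul_const ((3 : ℝ) ^ (1 / 2 + β))
    simpa using this
  rw [isLittleO_iff]
  intro c hc
  filter_upwards [hεk.eventually_le_const hc] with k hk
  have hk1 : (0 : ℝ) < (k : ℝ) + 1 := by positivity
  rw [Real.norm_of_nonneg (singularValue_nonneg T k), Real.norm_of_nonneg (by positivity)]
  refine (hmain (k / 3) k (by omega)).trans ?_
  refine le_trans ?_ (mul_le_mul_of_nonneg_right hk (by positivity))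
  rw [mul_assoc]
  refine mul_le_mul_of_nonneg_left ?_ (Real.sqrt_nonneg _)
  -- With `n = k / 3` rounded down, replacing `n + 1` by `(k + 1) / 3` costs only the factor `3 ^ (1
  -- / 2 + β)`.
  have h3 : ((k : ℝ) + 1) / 3 ≤ ((k / 3 : ℕ) : ℝ) + 1 := by
    have : k + 1 ≤ 3 * (k / 3 + 1) := by omega
    have : ((k : ℝ) + 1) ≤ 3 * (((k / 3 : ℕ) : ℝ) + 1) := by exact_mod_cast this
    linarith
  refine (Real.rpow_le_rpow_of_nonpos (by positivity) h3 (by linarith)).trans_eq ?_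
  rw [Real.div_rpow hk1.le (by norm_num), Real.rpow_neg (by norm_num : (0 : ℝ) ≤ 3), div_inv_eq_mul,
    mul_comm]

theorem memSchatten_of_isLittleO {T : H₁ →L[ℂ] H₂} (hT : IsCompactOperator T) {γ r : ℝ}
    (hr : 0 < r) (hrγ : 1 / r < γ)
    (h : (fun k : ℕ => singularValue T k) =o[atTop] fun k : ℕ => ((k : ℝ) + 1) ^ (-γ)) :
    MemSchatten r T := by
  refine ⟨hT, ?_⟩
  have h1 : 1 < γ * r := by rwa [div_lt_iff₀ hr] at hrγ
  have hs : Summable fun k : ℕ => ((k : ℝ) + 1) ^ (-(γ * r)) := by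
    have := (summable_nat_add_iff 1).2 (Real.summable_nat_rpow.2 (neg_lt_neg h1))
    simpa using this
  refine summable_of_isBigO_nat hs ?_
  rw [isLittleO_iff] at h
  refine IsBigO.of_bound 1 ?_
  filter_upwards [h one_pos] with k hk
  have hk1 : (0 : ℝ) < (k : ℝ) + 1 := by positivity
  have h0 := singularValue_nonneg T k
  rw [Real.norm_of_nonneg h0, Real.norm_of_nonneg (by positivity), one_mul] at hk
  rw [Real.norm_of_nonneg (by positivity), Real.norm_of_nonneg (by positivity), one_mul,
    ← neg_mul, Real.rpow_mul hk1.le]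
  exact Real.rpow_le_rpow h0 hk hr.le

theorem isCompactOperator_of_summable_matrix (T : H₁ →L[ℂ] H₂) (e : HilbertBasis ι₁ ℂ H₁)
    (d : HilbertBasis ι₂ ℂ H₂)
    (hT : Summable fun q : ι₂ × ι₁ => ‖⟪d q.1, T (e q.2)⟫_ℂ‖ ^ 2) : IsCompactOperator T := by
  refine isCompactOperator_of_summable T d (hT.prod.congr fun i => ?_)
  rw [← (e.hasSum_sq_norm_inner (ContinuousLinearMap.adjoint T (d i))).tsum_eq]
  exact tsum_congr fun j => by
    rw [norm_inner_symm (e j), ContinuousLinearMap.adjoint_inner_left]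

end HilbertSpace

/-! ### Eigenvalue growth and symmetry of the unbounded operators. -/

section Spectrum

open scoped InnerProductSpace

variable {H : Type*} [NormedAddCommGroup H] [InnerProductSpace ℂ H] [CompleteSpace H] {ι : Type*}

theorem HasDiscretePositiveSpectrum.exists_pos_le {A : H →ₗ.[ℂ] H} {lam : ι → ℝ}
    (h : HasDiscretePositiveSpectrum A lam) : ∃ m : ℝ, 0 < m ∧ ∀ j, m ≤ lam j := by
  rcases isEmpty_or_nonempty ι with hι | ⟨⟨j₀⟩⟩
  · exact ⟨1, one_pos, fun j => hι.elim j⟩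
  obtain ⟨i, -, hi⟩ := Set.exists_min_image {j | lam j ≤ lam j₀} lam (h.discrete (lam j₀))
    ⟨j₀, le_refl (lam j₀)⟩
  exact ⟨lam i, h.pos i, fun j =>
    (le_total (lam j) (lam j₀)).elim (hi j) fun hj => (hi j₀ (le_refl (lam j₀))).trans hj⟩

/-- The index sets of the lowest eigenvalues, for an eigenvalue counting function of
polynomial growth. -/
theorem HasDiscretePositiveSpectrum.exists_finset {A : H →ₗ.[ℂ] H} {lam : ι → ℝ}
    (h : HasDiscretePositiveSpectrum A lam) {C p : ℝ} (hC : 0 < C) (hp : 0 < p)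
    (hN : ∀ L : ℝ, 0 < L → (eigenvalueCount lam L : ℝ) ≤ C * (1 + L) ^ p) :
    ∃ c : ℝ, 0 < c ∧ ∃ J : ℕ → Finset ι, (∀ n, (J n).card ≤ n) ∧
      (∀ j, ∀ᶠ n in atTop, j ∈ J n) ∧
      ∀ n, ∀ j, j ∉ J n → ((n : ℝ) + 1) ^ (1 / p) ≤ c * lam j := by
  classical
  obtain ⟨m, hm, hml⟩ := h.exists_pos_le
  -- The level at which the counting bound `C * (1 + L) ^ p` equals `n`.
  set L : ℕ → ℝ := fun n => ((n : ℝ) / C) ^ (1 / p) - 1 with hL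
  -- The first term bounds `n`, using `1 + lam j ≤ (1 + 1 / m) * lam j`; the second absorbs the `+
  -- 1` in `n + 1`, using `1 ≤ lam j / m`.
  set D : ℝ := C * (1 + 1 / m) ^ p + (1 / m) ^ p with hD
  have hDpos : 0 < D := by positivity
  refine ⟨D ^ (1 / p), by positivity, fun n => (h.discrete (L n)).toFinset, fun n => ?_,
    fun j => ?_, fun n j hj => ?_⟩
  · dsimp only
    by_cases hLn : 0 < L n
    · have h1 := hN (L n) hLn
      have h2 : C * (1 + L n) ^ p = n := by
        rw [hL, add_sub_cancel, ← Real.rpow_mul (by positivity), one_div_mul_cancel hp.ne',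
          Real.rpow_one, mul_div_cancel₀ _ hC.ne']
      rw [h2, eigenvalueCount,
        Set.ncard_eq_toFinset_card _ (h.discrete (L n))] at h1
      exact_mod_cast h1
    -- The counting bound is only available at positive levels; below them there are no eigenvalues.
    · have : (h.discrete (L n)).toFinset = ∅ := by
        ext j
        have := h.pos j
        simp only [Set.Finite.mem_toFinset, Set.mem_ofPred_eq, Finset.notMem_empty, iff_false]
        linarith
      rw [this]
      simp
  · have ht : Tendsto L atTop atTop := by
      refine tendsto_atTop_add_const_right _ _ ?_
      exact (tendsto_rpow_atTop (by positivity)).comp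
        (tendsto_natCast_atTop_atTop.atTop_div_const hC)
    filter_upwards [ht.eventually_ge_atTop (lam j)] with n hn
    simpa using hn
  · have hj' : L n < lam j := by simpa using hj
    have hlam := h.pos j
    have h1m : 1 ≤ lam j / m := (one_le_div hm).2 (hml j)
    have h1 : ((n : ℝ) / C) ^ (1 / p) ≤ (1 + 1 / m) * lam j := by
      have : (1 + 1 / m) * lam j = lam j + lam j / m := by ring
      rw [this]
      simp only [hL] at hj'
      linarith
    have h2 : (n : ℝ) ≤ C * ((1 + 1 / m) * lam j) ^ p := by
      have := Real.rpow_le_rpow (by positivity) h1 hp.le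
      rw [← Real.rpow_mul (by positivity), one_div_mul_cancel hp.ne', Real.rpow_one,
        div_le_iff₀ hC] at this
      linarith
    have h3 : (1 : ℝ) ≤ (1 / m * lam j) ^ p := by
      refine Real.one_le_rpow ?_ hp.le
      rwa [one_div_mul_eq_div]
    have h4 : (n : ℝ) + 1 ≤ D * lam j ^ p := by
      rw [Real.mul_rpow (by positivity) hlam.le] at h2 h3
      rw [hD]
      linarith
    calc ((n : ℝ) + 1) ^ (1 / p) ≤ (D * lam j ^ p) ^ (1 / p) :=
          Real.rpow_le_rpow (by positivity) h4 (by positivity)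
      _ = D ^ (1 / p) * lam j := by
          rw [Real.mul_rpow hDpos.le (by positivity), ← Real.rpow_mul hlam.le,
            mul_one_div_cancel hp.ne', Real.rpow_one]

/-- Symmetry moves the operator onto the eigenvector, and the eigenvalue is real. -/
theorem IsSelfAdjoint.inner_apply_of_eigenvector {A : H →ₗ.[ℂ] H} (hA : IsSelfAdjoint A)
    {b : H} {l : ℝ} (hb : ∃ h : b ∈ A.domain, A ⟨b, h⟩ = (l : ℂ) • b) (u : A.domain) :
    ⟪b, A u⟫_ℂ = l * ⟪b, (u : H)⟫_ℂ := by
  obtain ⟨h, hAb⟩ := hb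
  have hf := LinearPMap.adjoint_isFormalAdjoint hA.dense_domain
  rw [LinearPMap.isSelfAdjoint_def.1 hA] at hf
  have := hf u ⟨b, h⟩
  have h2 := congrArg (starRingEnd ℂ) this
  rw [inner_conj_symm, inner_conj_symm, hAb, inner_smul_left] at h2
  simpa using h2

end Spectrum

/-! ### Complex conjugation on `L²`. -/

section Conjugation

open scoped InnerProductSpace

variable {Ω ι : Type*} [MeasurableSpace Ω] {μ : Measure Ω}

/-- The integral operator pairs the kernel with `f` without conjugation, so as an inner product it
involves `star f`. This is why conjugated eigenbases are needed. -/
theorem inner_star_left_Lp (f g : Lp ℂ 2 μ) : ⟪star f, g⟫_ℂ = ∫ y, g y * f y ∂μ := by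
  rw [L2.inner_def]
  refine integral_congr_ae ?_
  filter_upwards [Lp.coeFn_star f] with y hy
  simp [hy, mul_comm]

theorem inner_star_star_Lp (f g : Lp ℂ 2 μ) : ⟪star f, star g⟫_ℂ = ⟪g, f⟫_ℂ := by
  rw [inner_star_left_Lp, L2.inner_def]
  refine integral_congr_ae ?_
  filter_upwards [Lp.coeFn_star g] with y hy
  simp [hy, mul_comm]

theorem Orthonormal.star_Lp {v : ι → Lp ℂ 2 μ} (hv : Orthonormal ℂ v) :
    Orthonormal ℂ fun j => star (v j) := by
  classical
  rw [orthonormal_iff_ite] at hv ⊢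
  intro i j
  rw [inner_star_star_Lp, hv j i]
  simp only [eq_comm]

theorem HilbertBasis.exists_star_Lp (b : HilbertBasis ι ℂ (Lp ℂ 2 μ)) :
    ∃ e : HilbertBasis ι ℂ (Lp ℂ 2 μ), ∀ j, e j = star (b j) := by
  refine ⟨HilbertBasis.mkOfOrthogonalEqBot b.orthonormal.star_Lp ?_, fun j => by
    rw [HilbertBasis.coe_mkOfOrthogonalEqBot]⟩
  rw [Submodule.eq_bot_iff]
  intro f hf
  have h1 : ∀ j, ⟪b j, star f⟫_ℂ = 0 := by
    intro j
    have h := (Submodule.mem_orthogonal _ _).1 hf _ (Submodule.subset_span ⟨j, rfl⟩)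
    rw [← inner_star_star_Lp, star_star, ← inner_conj_symm, h, map_zero]
  have h2 : star f = 0 := by
    have h := (b.hasSum_sq_norm_inner (star f)).tsum_eq
    simpa [h1] using h.symm
  have h3 : ⟪f, f⟫_ℂ = 0 := by rw [← inner_star_star_Lp, h2, inner_zero_left]
  exact inner_self_eq_zero.1 h3

end Conjugation

/-! ### Matrix entries of integral operators and of transformed kernels. -/

section Kernels

open scoped InnerProductSpace

variable {Ω₁ Ω₂ ι₁ ι₂ : Type*} [MeasurableSpace Ω₁] [MeasurableSpace Ω₂]
  {μ₁ : Measure Ω₁} {μ₂ : Measure Ω₂} [SigmaFinite μ₁] {K F G : Ω₂ × Ω₁ → ℂ}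

theorem integralOperator_apply_eq_inner (hK : MemLp K 2 (μ₂.prod μ₁)) (f : Lp ℂ 2 μ₁) :
    ∀ᵐ x ∂μ₂, ∀ h : MemLp (fun y => K (x, y)) 2 μ₁,
      integralOperator hK f x = ⟪star f, h.toLp⟫_ℂ := by
  filter_upwards [integralOperator_apply hK f] with x hx h
  rw [hx, inner_star_left_Lp]
  refine integral_congr_ae ?_
  filter_upwards [h.coeFn_toLp] with y hy
  rw [hy]

/-- Bessel's inequality for the slice `K (x, ·)` against the conjugated system, integrated over `x`.
-/
theorem sum_enorm_integralOperator_sq_le (hK : MemLp K 2 (μ₂.prod μ₁)) {e : ι₁ → Lp ℂ 2 μ₁}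
    (he : Orthonormal ℂ e) (J : Finset ι₁) :
    ∑ j ∈ J, ‖integralOperator hK (e j)‖ₑ ^ 2 ≤ eLpNorm K 2 (μ₂.prod μ₁) ^ 2 := by
  have hm : AEMeasurable (fun z => ‖K z‖ₑ ^ 2) (μ₂.prod μ₁) := hK.1.enorm.pow_const 2
  simp_rw [Lp.enorm_def, sq_eLpNorm_two]
  rw [lintegral_prod _ hm, ← lintegral_finsetSum' _ fun j _ =>
    (Lp.aestronglyMeasurable (integralOperator hK (e j))).enorm.pow_const 2]
  refine lintegral_mono_ae ?_
  have h1 : ∀ᵐ x ∂μ₂, ∀ j : J, ∀ h : MemLp (fun y => K (x, y)) 2 μ₁,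
      integralOperator hK (e j) x = ⟪star (e j), h.toLp⟫_ℂ :=
    ae_all_iff.2 fun j => integralOperator_apply_eq_inner hK (e j)
  filter_upwards [kernel_slice_memLp hK, h1] with x hx h1
  rw [← sq_eLpNorm_two μ₁ (fun y => K (x, y)), ← Lp.enorm_toLp (hf := hx)]
  have hB := he.star_Lp.sum_inner_products_le hx.toLp (s := J)
  have hcast : ∀ {V : Type _} [SeminormedAddCommGroup V] (v : V),
      ‖v‖ₑ ^ 2 = ENNReal.ofReal (‖v‖ ^ 2) := fun v => by
    rw [ENNReal.ofReal_pow (norm_nonneg _), ofReal_norm]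
  rw [hcast hx.toLp]
  refine le_trans (le_of_eq ?_) (ENNReal.ofReal_le_ofReal hB)
  rw [ENNReal.ofReal_sum_of_nonneg fun _ _ => by positivity]
  refine Finset.sum_congr rfl fun j hj => ?_
  rw [h1 ⟨j, hj⟩ hx, ENNReal.ofReal_pow (norm_nonneg _), ofReal_norm]

theorem summable_sq_norm_of_sum_enorm_le {ι E : Type*} [SeminormedAddCommGroup E] {u : ι → E}
    {B : ℝ≥0∞} (hB : B ≠ ∞) (h : ∀ J : Finset ι, ∑ j ∈ J, ‖u j‖ₑ ^ 2 ≤ B) :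
    Summable fun j => ‖u j‖ ^ 2 := by
  refine summable_of_sum_le (c := B.toReal) (fun _ => by positivity) fun J => ?_
  have h := ENNReal.toReal_mono hB (h J)
  rw [ENNReal.toReal_sum fun j _ => ENNReal.pow_ne_top enorm_ne_top] at h
  simpa using h

/-- Integral operators with square integrable kernels are Hilbert-Schmidt operators. -/
theorem summable_matrix_integralOperator (hK : MemLp K 2 (μ₂.prod μ₁))
    (e : HilbertBasis ι₁ ℂ (Lp ℂ 2 μ₁)) (d : HilbertBasis ι₂ ℂ (Lp ℂ 2 μ₂)) :
    Summable fun q : ι₂ × ι₁ => ‖⟪d q.1, integralOperator hK (e q.2)⟫_ℂ‖ ^ 2 :=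
  d.summable_matrix_of_summable_columns (u := fun j => integralOperator hK (e j))
    (summable_sq_norm_of_sum_enorm_le (ENNReal.pow_ne_top hK.2.ne)
      (sum_enorm_integralOperator_sq_le hK e.orthonormal))

/-- Pointwise in `x`, both sides are `⟪b, A K(x, ·)⟫ = l * ⟪b, K(x, ·)⟫`, since the integral
operator applied to `star b` pairs slices with `b`. -/
theorem ActsOnY.integralOperator_star {A : Lp ℂ 2 μ₁ →ₗ.[ℂ] Lp ℂ 2 μ₁} (hA : IsSelfAdjoint A)
    (hK : MemLp K 2 (μ₂.prod μ₁)) (hF : MemLp F 2 (μ₂.prod μ₁)) (h : ActsOnY μ₂ A K F)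
    {b : Lp ℂ 2 μ₁} {l : ℝ} (hb : ∃ h : b ∈ A.domain, A ⟨b, h⟩ = (l : ℂ) • b) :
    integralOperator hF (star b) = (l : ℂ) • integralOperator hK (star b) := by
  refine Lp.ext ?_
  filter_upwards [integralOperator_apply_eq_inner hK (star b),
    integralOperator_apply_eq_inner hF (star b), h.2, kernel_slice_memLp hF,
    Lp.coeFn_smul (l : ℂ) (integralOperator hK (star b))] with x h1 h2 ⟨h3, h4, h5⟩ h6 h7
  rw [h7, Pi.smul_apply, h1 h3, h2 h6, star_star, smul_eq_mul]
  have h8 : A ⟨h3.toLp, h4⟩ = h6.toLp := Lp.ext (h5.trans h6.coeFn_toLp.symm)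
  rw [← h8]
  exact hA.inner_apply_of_eigenvector hb ⟨h3.toLp, h4⟩

variable [SigmaFinite μ₂]

theorem memLp_two_mul_prod {f : Ω₂ → ℂ} {g : Ω₁ → ℂ} (hf : MemLp f 2 μ₂) (hg : MemLp g 2 μ₁) :
    MemLp (fun z : Ω₂ × Ω₁ => f z.1 * g z.2) 2 (μ₂.prod μ₁) := by
  have hm : AEStronglyMeasurable (fun z : Ω₂ × Ω₁ => f z.1 * g z.2) (μ₂.prod μ₁) :=
    hf.1.comp_fst.mul hg.1.comp_snd
  rw [memLp_two_iff_integrable_sq_norm hm]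
  simp_rw [norm_mul, mul_pow]
  exact ((memLp_two_iff_integrable_sq_norm hf.1).1 hf).mul_prod
    ((memLp_two_iff_integrable_sq_norm hg.1).1 hg)

/-- Fubini, so that the inner integral runs over a slice in `x`, where an operator acting in the
first variable can be used. -/
theorem inner_integralOperator (hK : MemLp K 2 (μ₂.prod μ₁)) (d : Lp ℂ 2 μ₂) (f : Lp ℂ 2 μ₁) :
    ⟪d, integralOperator hK f⟫_ℂ =
      ∫ y, (∫ x, K (x, y) * starRingEnd ℂ (d x) ∂μ₂) * f y ∂μ₁ := by
  have hint : Integrable (fun z : Ω₂ × Ω₁ => K z * (starRingEnd ℂ (d z.1) * f z.2))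
      (μ₂.prod μ₁) :=
    hK.integrable_mul (memLp_two_mul_prod (Lp.memLp d).star (Lp.memLp f))
  rw [L2.inner_def]
  calc ∫ x, ⟪d x, integralOperator hK f x⟫_ℂ ∂μ₂
      = ∫ x, ∫ y, K (x, y) * (starRingEnd ℂ (d x) * f y) ∂μ₁ ∂μ₂ := by
        refine integral_congr_ae ?_
        filter_upwards [integralOperator_apply hK f] with x hx
        rw [hx, RCLike.inner_apply, ← integral_mul_const]
        exact integral_congr_ae (Eventually.of_forall fun y => by ring)
    _ = ∫ y, ∫ x, K (x, y) * (starRingEnd ℂ (d x) * f y) ∂μ₂ ∂μ₁ := integral_integral_swap hint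
    _ = _ := by
        refine integral_congr_ae (Eventually.of_forall fun y => ?_)
        simp only
        rw [← integral_mul_const]
        exact integral_congr_ae (Eventually.of_forall fun x => by ring)

theorem inner_toLp {Ω : Type*} [MeasurableSpace Ω] {μ : Measure Ω} (d : Lp ℂ 2 μ) {u : Ω → ℂ}
    (hu : MemLp u 2 μ) : ⟪d, hu.toLp⟫_ℂ = ∫ x, u x * starRingEnd ℂ (d x) ∂μ := by
  rw [L2.inner_def]
  refine integral_congr_ae ?_
  filter_upwards [hu.coeFn_toLp] with x hx
  rw [hx, RCLike.inner_apply]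

theorem ActsOnX.inner_integralOperator {A : Lp ℂ 2 μ₂ →ₗ.[ℂ] Lp ℂ 2 μ₂} (hA : IsSelfAdjoint A)
    (hF : MemLp F 2 (μ₂.prod μ₁)) (hG : MemLp G 2 (μ₂.prod μ₁)) (h : ActsOnX μ₁ A F G)
    {b : Lp ℂ 2 μ₂} {l : ℝ} (hb : ∃ h : b ∈ A.domain, A ⟨b, h⟩ = (l : ℂ) • b) (f : Lp ℂ 2 μ₁) :
    ⟪b, integralOperator hG f⟫_ℂ = l * ⟪b, integralOperator hF f⟫_ℂ := by
  rw [_root_.inner_integralOperator, _root_.inner_integralOperator, ← integral_const_mul]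
  refine integral_congr_ae ?_
  filter_upwards [h.2] with y ⟨h1, h2, h3⟩
  have h4 : MemLp (fun x => G (x, y)) 2 μ₂ := (memLp_congr_ae h3).1 (Lp.memLp _)
  have h5 : A ⟨h1.toLp, h2⟩ = h4.toLp := Lp.ext (h3.trans h4.coeFn_toLp.symm)
  have h6 := hA.inner_apply_of_eigenvector hb ⟨h1.toLp, h2⟩
  rw [h5, inner_toLp b h4, inner_toLp b h1] at h6
  rw [h6, mul_assoc]

theorem HasDiscretePositiveSpectrum.exists_norm_le {H ι : Type*} [NormedAddCommGroup H]
    [InnerProductSpace ℂ H] [CompleteSpace H] {A : H →ₗ.[ℂ] H} (hA : IsSelfAdjoint A)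
    {lam : ι → ℝ} (h : HasDiscretePositiveSpectrum A lam) :
    ∃ c : ℝ, 0 ≤ c ∧ ∀ u : A.domain, ‖(u : H)‖ ≤ c * ‖A u‖ := by
  obtain ⟨m, hm, hml⟩ := h.exists_pos_le
  obtain ⟨b, hb⟩ := h.eigenbasis
  refine ⟨m⁻¹, by positivity, fun u => ?_⟩
  rw [inv_mul_eq_div, le_div_iff₀ hm]
  refine le_of_sq_le_sq ?_ (norm_nonneg _)
  rw [mul_pow]
  refine hasSum_le (fun j => ?_) ((b.hasSum_sq_norm_inner (u : H)).mul_right (m ^ 2))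
    (b.hasSum_sq_norm_inner (A u))
  rw [hA.inner_apply_of_eigenvector (hb j), norm_mul, mul_pow, mul_comm]
  have : m ≤ ‖(lam j : ℂ)‖ := by
    rw [Complex.norm_real]; exact (hml j).trans (le_abs_self _)
  gcongr

/-- The intermediate kernel of the two-sided condition is not assumed square integrable. It is,
because an operator with spectrum bounded away from `0` is bounded below: the slices of `F` are
controlled by those of `G`, uniformly in `y`. -/
theorem ActsOnX.memLp {A : Lp ℂ 2 μ₂ →ₗ.[ℂ] Lp ℂ 2 μ₂} (hA : IsSelfAdjoint A)
    {lam : ι₂ → ℝ} (hs : HasDiscretePositiveSpectrum A lam)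
    (hF : AEStronglyMeasurable F (μ₂.prod μ₁)) (hG : MemLp G 2 (μ₂.prod μ₁))
    (h : ActsOnX μ₁ A F G) : MemLp F 2 (μ₂.prod μ₁) := by
  obtain ⟨c, hc, hcA⟩ := hs.exists_norm_le hA
  have hm : AEMeasurable (fun z => ‖F z‖ₑ ^ 2) (μ₂.prod μ₁) := hF.enorm.pow_const 2
  have hm' : AEMeasurable (fun z => ‖G z‖ₑ ^ 2) (μ₂.prod μ₁) := hG.1.enorm.pow_const 2
  have hle : eLpNorm F 2 (μ₂.prod μ₁) ^ 2 ≤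
      ENNReal.ofReal c ^ 2 * eLpNorm G 2 (μ₂.prod μ₁) ^ 2 := by
    rw [sq_eLpNorm_two, sq_eLpNorm_two, lintegral_prod_symm _ hm, lintegral_prod_symm _ hm',
      ← lintegral_const_mul' _ _ (by simp)]
    refine lintegral_mono_ae ?_
    filter_upwards [h.2] with y ⟨h1, h2, h3⟩
    have h4 := hcA ⟨h1.toLp, h2⟩
    rw [← sq_eLpNorm_two μ₂ (fun x => F (x, y)), ← sq_eLpNorm_two μ₂ (fun x => G (x, y)),
      ← mul_pow, ← eLpNorm_congr_ae h3, ← Lp.enorm_def, ← Lp.enorm_toLp (hf := h1)]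
    gcongr
    rw [← ofReal_norm, ← ofReal_norm, ← ENNReal.ofReal_mul hc]
    exact ENNReal.ofReal_le_ofReal h4
  refine ⟨hF, ?_⟩
  have hlt : eLpNorm F 2 (μ₂.prod μ₁) ^ 2 < ∞ := hle.trans_lt
    (ENNReal.mul_lt_top (ENNReal.pow_lt_top ENNReal.ofReal_lt_top) (ENNReal.pow_lt_top hG.2))
  by_contra hne
  rw [not_lt, top_le_iff] at hne
  simp [hne] at hlt

/-- Schatten class membership and decay of the singular values of an integral operator whose
matrix is dominated, outside a growing family of rows and columns, by that of a second one. -/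
theorem schatten_and_isLittleO (hK : MemLp K 2 (μ₂.prod μ₁)) (hG : MemLp G 2 (μ₂.prod μ₁))
    (e : HilbertBasis ι₁ ℂ (Lp ℂ 2 μ₁)) (d : HilbertBasis ι₂ ℂ (Lp ℂ 2 μ₂))
    {β γ c : ℝ} (hβ : 0 ≤ β) (hγ : γ = 1 / 2 + β) (J₁ : ℕ → Finset ι₁) (J₂ : ℕ → Finset ι₂)
    (hJ₁ : ∀ n, (J₁ n).card ≤ n) (hJ₂ : ∀ n, (J₂ n).card ≤ n)
    (hJ : ∀ q : ι₂ × ι₁, ∀ᶠ n in atTop, q.1 ∈ J₂ n ∨ q.2 ∈ J₁ n)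
    (hbound : ∀ n, ∀ q : ι₂ × ι₁, q.1 ∉ J₂ n → q.2 ∉ J₁ n →
      ((n : ℝ) + 1) ^ β * ‖⟪d q.1, integralOperator hK (e q.2)⟫_ℂ‖ ≤
        c * ‖⟪d q.1, integralOperator hG (e q.2)⟫_ℂ‖) :
    (∀ r : ℝ, 0 < r → 1 / r < γ → MemSchatten r (integralOperator hK)) ∧
      (fun k : ℕ => singularValue (integralOperator hK) k) =o[atTop]
        (fun k : ℕ => ((k : ℝ) + 1) ^ (-γ)) := by
  subst hγ
  have hsum := summable_matrix_integralOperator hK e d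
  have ha := (summable_matrix_integralOperator hG e d).mul_left (c ^ 2)
  simp_rw [← mul_pow] at ha
  have ho := singularValue_isLittleO _ e d hsum _ ha β hβ J₁ J₂ hJ₁ hJ₂ hJ hbound
  exact ⟨fun r hr hrγ =>
    memSchatten_of_isLittleO (isCompactOperator_of_summable_matrix _ e d hsum) hr hrγ ho, ho⟩

end Kernels

/-! ### Assembly of the three cases. -/

theorem mainTheorem2 {Ω₁ Ω₂ ι₁ ι₂ : Type*} [MeasurableSpace Ω₁] [MeasurableSpace Ω₂]
    (μ₁ : Measure Ω₁) (μ₂ : Measure Ω₂) [SigmaFinite μ₁] [SigmaFinite μ₂]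
    (K : Ω₂ × Ω₁ → ℂ) (hK : MemLp K 2 (μ₂.prod μ₁)) :
    -- two-sided condition: `(E₂)_x (E₁)_y K ∈ L²`
    (∀ (E₁ : Lp ℂ 2 μ₁ →ₗ.[ℂ] Lp ℂ 2 μ₁) (E₂ : Lp ℂ 2 μ₂ →ₗ.[ℂ] Lp ℂ 2 μ₂)
      (lam₁ : ι₁ → ℝ) (lam₂ : ι₂ → ℝ) (C₁ p₁ C₂ p₂ : ℝ),
      IsEssentiallySelfAdjoint E₁ → IsEssentiallySelfAdjoint E₂ →
      HasDiscretePositiveSpectrum E₁.closure lam₁ →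
      HasDiscretePositiveSpectrum E₂.closure lam₂ →
      0 < C₁ → 0 < p₁ → 0 < C₂ → 0 < p₂ →
      (∀ L : ℝ, 0 < L → (eigenvalueCount lam₁ L : ℝ) ≤ C₁ * (1 + L) ^ p₁) →
      (∀ L : ℝ, 0 < L → (eigenvalueCount lam₂ L : ℝ) ≤ C₂ * (1 + L) ^ p₂) →
      (∃ F G : Ω₂ × Ω₁ → ℂ, ActsOnY μ₂ E₁.closure K F ∧ ActsOnX μ₁ E₂.closure F G ∧
        MemLp G 2 (μ₂.prod μ₁)) →
      (∀ r : ℝ, 0 < r → 1 / r < 1 / 2 + 1 / p₁ + 1 / p₂ →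
        MemSchatten r (integralOperator hK)) ∧
      (fun k : ℕ => singularValue (integralOperator hK) k) =o[atTop]
        (fun k : ℕ => ((k : ℝ) + 1) ^ (-(1 / 2 + 1 / p₁ + 1 / p₂)))) ∧
    -- one-sided condition in the second variable: `E_y K ∈ L²`
    (∀ (E : Lp ℂ 2 μ₁ →ₗ.[ℂ] Lp ℂ 2 μ₁) (lam : ι₁ → ℝ) (C p : ℝ),
      IsEssentiallySelfAdjoint E →
      HasDiscretePositiveSpectrum E.closure lam →
      0 < C → 0 < p →
      (∀ L : ℝ, 0 < L → (eigenvalueCount lam L : ℝ) ≤ C * (1 + L) ^ p) →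
      (∃ G : Ω₂ × Ω₁ → ℂ, ActsOnY μ₂ E.closure K G ∧ MemLp G 2 (μ₂.prod μ₁)) →
      (∀ r : ℝ, 0 < r → 1 / r < 1 / 2 + 1 / p → MemSchatten r (integralOperator hK)) ∧
      (fun k : ℕ => singularValue (integralOperator hK) k) =o[atTop]
        (fun k : ℕ => ((k : ℝ) + 1) ^ (-(1 / 2 + 1 / p)))) ∧
    -- one-sided condition in the first variable: `E_x K ∈ L²`
    (∀ (E : Lp ℂ 2 μ₂ →ₗ.[ℂ] Lp ℂ 2 μ₂) (lam : ι₂ → ℝ) (C p : ℝ),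
      IsEssentiallySelfAdjoint E →
      HasDiscretePositiveSpectrum E.closure lam →
      0 < C → 0 < p →
      (∀ L : ℝ, 0 < L → (eigenvalueCount lam L : ℝ) ≤ C * (1 + L) ^ p) →
      (∃ G : Ω₂ × Ω₁ → ℂ, ActsOnX μ₁ E.closure K G ∧ MemLp G 2 (μ₂.prod μ₁)) →
      (∀ r : ℝ, 0 < r → 1 / r < 1 / 2 + 1 / p → MemSchatten r (integralOperator hK)) ∧
      (fun k : ℕ => singularValue (integralOperator hK) k) =o[atTop]
        (fun k : ℕ => ((k : ℝ) + 1) ^ (-(1 / 2 + 1 / p)))) := by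
  refine ⟨?_, ?_, ?_⟩
  · rintro E₁ E₂ lam₁ lam₂ C₁ p₁ C₂ p₂ hE₁ hE₂ hs₁ hs₂ hC₁ hp₁ hC₂ hp₂ hN₁ hN₂ ⟨F, G, hKF, hFG, hG⟩
    obtain ⟨c₁, hc₁, J₁, hJ₁, hJ₁', hb₁⟩ := hs₁.exists_finset hC₁ hp₁ hN₁
    obtain ⟨c₂, hc₂, J₂, hJ₂, hJ₂', hb₂⟩ := hs₂.exists_finset hC₂ hp₂ hN₂
    obtain ⟨b, hb⟩ := hs₁.eigenbasis
    obtain ⟨e, he⟩ := b.exists_star_Lp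
    obtain ⟨d, hd⟩ := hs₂.eigenbasis
    have hF := hFG.memLp hE₂.2 hs₂ hKF.1 hG
    refine schatten_and_isLittleO (c := c₁ * c₂) hK hG e d
      (by positivity : 0 ≤ 1 / p₁ + 1 / p₂) (add_assoc _ _ _) J₁ J₂ hJ₁ hJ₂
      (fun q => (hJ₁' q.2).mono fun n hn => Or.inr hn) fun n q h2 h1 => ?_
    -- Each entry for `G` is `lam₂ * lam₁` times the entry for `K`, passing through `F`.
    rw [hFG.inner_integralOperator hE₂.2 hF hG (hd q.1), he,
      hKF.integralOperator_star hE₁.2 hK hF (hb q.2), inner_smul_right, norm_mul, norm_mul,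
      Complex.norm_real, Complex.norm_real, Real.norm_of_nonneg (hs₁.pos _).le,
      Real.norm_of_nonneg (hs₂.pos _).le, Real.rpow_add (by positivity)]
    calc ((n : ℝ) + 1) ^ (1 / p₁) * ((n : ℝ) + 1) ^ (1 / p₂) * _
        ≤ (c₁ * lam₁ q.2) * (c₂ * lam₂ q.1) * _ := by
          have := hb₁ n q.2 h1
          have := hb₂ n q.1 h2
          have := hs₁.pos q.2
          gcongr
      _ = _ := by ring
  · rintro E lam C p hE hs hC hp hN ⟨G, hKG, hG⟩
    obtain ⟨c, hc, J, hJ, hJ', hb⟩ := hs.exists_finset hC hp hN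
    obtain ⟨b, hbE⟩ := hs.eigenbasis
    obtain ⟨e, he⟩ := b.exists_star_Lp
    -- With no operator on this side, any basis serves and no rows are removed.
    obtain ⟨s, d, -⟩ := exists_hilbertBasis ℂ (Lp ℂ 2 μ₂)
    refine schatten_and_isLittleO (c := c) hK hG e d (by positivity : 0 ≤ 1 / p) rfl
      J (fun _ => ∅) hJ (fun _ => by simp)
      (fun q => (hJ' q.2).mono fun n hn => Or.inr hn) fun n q _ h1 => ?_
    rw [he, hKG.integralOperator_star hE.2 hK hG (hbE q.2), inner_smul_right, norm_mul,
      Complex.norm_real, Real.norm_of_nonneg (hs.pos _).le, ← mul_assoc]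
    exact mul_le_mul_of_nonneg_right (hb n q.2 h1) (norm_nonneg _)
  · rintro E lam C p hE hs hC hp hN ⟨G, hKG, hG⟩
    obtain ⟨c, hc, J, hJ, hJ', hb⟩ := hs.exists_finset hC hp hN
    obtain ⟨d, hd⟩ := hs.eigenbasis
    obtain ⟨s, e, -⟩ := exists_hilbertBasis ℂ (Lp ℂ 2 μ₁)
    refine schatten_and_isLittleO (c := c) hK hG e d (by positivity : 0 ≤ 1 / p) rfl
      (fun _ => ∅) J (fun _ => by simp) hJ
      (fun q => (hJ' q.1).mono fun n hn => Or.inl hn) fun n q h2 _ => ?_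
    rw [hKG.inner_integralOperator hE.2 hK hG (hd q.1), norm_mul,
      Complex.norm_real, Real.norm_of_nonneg (hs.pos _).le, ← mul_assoc]
    exact mul_le_mul_of_nonneg_right (hb n q.1 h2) (norm_nonneg _)
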